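/- Let $\mathcal I$ be a non-empty finite set of agents and $\mathsf{Prop}$ a countable set of propositional variables. The modal operators are $\mathsf K_i$ ($i\in\mathcal I$) and $\mathsf C$; below, $\Box$ ranges over all of them. The set $\mathrm{I}\Phi_{\mathrm{CKL}}$ of formulas of infinitary common knowledge logic is the least set that contains the propositional variables, $\top$ and $\bot$, is closed under $\land$, $\neg$ and the modal operators, and contains $\bigvee\Gamma$ and $\bigwedge\Gamma$ for every countable (possibly finite or empty) set $\Gamma$ of its elements. Write $\phi\lor\psi$ for $\neg(\neg\phi\land\neg\psi)$, $\phi\supset\psi$ for $\neg\phi\lor\psi$, and $\mathsf E\phi$ for the finite conjunction $\bigwedge_{i\in\mathcal I}\mathsf K_i\phi$. The proof system $\mathbf{IPS}_{\mathrm{MH}}$ has the following axiom schemas, for all formulas $\phi,\psi$, all modal operators $\Box$, all countable sets $\Gamma$ of formulas and all $\gamma\in\Gamma$: (1) all (instances of) propositional tautologies; (2) $\Box(\phi\supset\psi)\supset(\Box\phi\supset\Box\psi)$; (3) $\mathsf C\phi\supset\phi$; (4) $\mathsf C\phi\supset\mathsf E\mathsf C\phi$; (5) $\mathsf C(\phi\supset\mathsf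 E\phi)\supset(\phi\supset\mathsf C\phi)$; (6) $\bigwedge\{\Box\gamma\mid\gamma\in\Gamma\}\supset\Box\bigwedge\Gamma$; (7) $\gamma\supset\bigvee\Gamma$ and $\bigwedge\Gamma\supset\gamma$; and the following inference rules: modus ponens; uniform substitution of formulas for propositional variables; necessitation (from $\phi$ infer $\Box\phi$); from $\gamma\supset\phi$ for all $\gamma\in\Gamma$ infer $\bigvee\Gamma\supset\phi$; from $\phi\supset\gamma$ for all $\gamma\in\Gamma$ infer $\phi\supset\bigwedge\Gamma$ ($\Gamma$ any countable set of formulas). A Kripke frame is a non-empty set $W$ with binary relations $R_{\mathsf K_i}$ ($i\in\mathcal I$) and $R_{\mathsf C}$ on $W$. It is a CKL-frame if $R_{\mathsf C}$ is the reflexive and transitive closure of $R_{\mathsf E}=\bigcup_{i\in\mathcal I}R_{\mathsf K_i}$; $\mathbf{Frm}_{\mathrm{CKL}}$ is the class of all CKL-frames. A valuation $v:\mathsf{Prop}\to\mathcal P(W)$ extends to all formulas by $v(\top)=W$, $v(\bot)=\emptyset$, $v(\phi\land\psi)=v(\phi)\cap v(\psi)$, $v(\neg\phi)=W\setminus v(\phi)$,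 $v(\Box\phi)=\{w\in W\mid \forall u\in W\,((w,u)\in R_\Box\Rightarrow u\in v(\phi))\}$, $v(\bigvee\Gamma)=\bigcup_{\gamma\in\Gamma}v(\gamma)$ and $v(\bigwedge\Gamma)=\bigcap_{\gamma\in\Gamma}v(\gamma)$. A formula $\phi$ is valid in $\mathbf{Frm}_{\mathrm{CKL}}$ if $v(\phi)=W$ for every CKL-frame and every valuation $v$ in it. Theorem. For each formula $\phi\in\mathrm{I}\Phi_{\mathrm{CKL}}$, $\phi$ is provable in $\mathbf{IPS}_{\mathrm{MH}}$ if and only if $\phi$ is valid in the class $\mathbf{Frm}_{\mathrm{CKL}}$. -/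

import Mathlib

universe u v w

namespace CKL

/-! ## Formulas -/

/-- The modal operators of the language: `K i` for each agent `i`, and `C` (common knowledge). -/
inductive Modality (I : Type*) where
  | K (i : I) : Modality I
  | C : Modality I

/-- Raw formulas: countable disjunctions and conjunctions are taken over families indexed by a set
of natural numbers.  The formulas proper (`Formula`) arise by identifying families with the same
set of members, hereditarily. -/
inductive PreFormula (P I : Type*) where
  | var (p : P) : PreFormula P I
  | top : PreFormula P I
  | bot : PreFormula P I
  | and (φ ψ : PreFormula P I) : PreFormula P I
  | neg (φ : PreFormula P I) : PreFormula P I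
  | box (m : Modality I) (φ : PreFormula P I) : PreFormula P I
  | ior (S : Set ℕ) (f : S → PreFormula P I) : PreFormula P I
  | iand (S : Set ℕ) (f : S → PreFormula P I) : PreFormula P I

namespace PreFormula

variable {P I : Type*}

/-- Two raw formulas are equal up to the enumeration of the countable sets occurring in them. -/
inductive Ext : PreFormula P I → PreFormula P I → Prop
  | var (p : P) : Ext (var p) (var p)
  | top : Ext top top
  | bot : Ext bot bot
  | and {φ φ' ψ ψ' : PreFormula P I} : Ext φ φ' → Ext ψ ψ' → Ext (and φ ψ) (and φ' ψ')
  | neg {φ φ' : PreFormula P I} : Ext φ φ' → Ext (neg φ) (neg φ')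
  | box (m : Modality I) {φ φ' : PreFormula P I} : Ext φ φ' → Ext (box m φ) (box m φ')
  | ior {S T : Set ℕ} {f : S → PreFormula P I} {g : T → PreFormula P I} (a : S → T) (b : T → S) :
      (∀ s, Ext (f s) (g (a s))) → (∀ t, Ext (f (b t)) (g t)) → Ext (ior S f) (ior T g)
  | iand {S T : Set ℕ} {f : S → PreFormula P I} {g : T → PreFormula P I} (a : S → T) (b : T → S) :
      (∀ s, Ext (f s) (g (a s))) → (∀ t, Ext (f (b t)) (g t)) → Ext (iand S f) (iand T g)

theorem Ext.refl (φ : PreFormula P I) : Ext φ φ := by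
  induction φ with
  | var p => exact .var p
  | top => exact .top
  | bot => exact .bot
  | and φ ψ h₁ h₂ => exact .and h₁ h₂
  | neg φ h => exact .neg h
  | box m φ h => exact .box m h
  | ior S f h => exact .ior id id h h
  | iand S f h => exact .iand id id h h

theorem Ext.symm {φ ψ : PreFormula P I} (h : Ext φ ψ) : Ext ψ φ := by
  induction h with
  | var p => exact .var p
  | top => exact .top
  | bot => exact .bot
  | and _ _ h₁ h₂ => exact .and h₁ h₂
  | neg _ h => exact .neg h
  | box m _ h => exact .box m h
  | ior a b _ _ h₁ h₂ => exact .ior b a h₂ h₁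
  | iand a b _ _ h₁ h₂ => exact .iand b a h₂ h₁

theorem Ext.trans {φ ψ χ : PreFormula P I} (h : Ext φ ψ) (h' : Ext ψ χ) : Ext φ χ := by
  induction h generalizing χ with
  | var p => exact h'
  | top => exact h'
  | bot => exact h'
  | and _ _ h₁ h₂ => cases h' with | and k₁ k₂ => exact .and (h₁ k₁) (h₂ k₂)
  | neg _ h => cases h' with | neg k => exact .neg (h k)
  | box m _ h => cases h' with | box _ k => exact .box m (h k)
  | ior a b _ _ h₁ h₂ =>
    cases h' with
    | ior c d k₁ k₂ =>
      exact .ior (c ∘ a) (b ∘ d) (fun s => h₁ s (k₁ _)) (fun t => h₂ _ (k₂ t))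
  | iand a b _ _ h₁ h₂ =>
    cases h' with
    | iand c d k₁ k₂ =>
      exact .iand (c ∘ a) (b ∘ d) (fun s => h₁ s (k₁ _)) (fun t => h₂ _ (k₂ t))

instance setoid (P I : Type*) : Setoid (PreFormula P I) :=
  ⟨Ext, Ext.refl, Ext.symm, Ext.trans⟩

end PreFormula

/-- Formulas of infinitary common knowledge logic over the propositional variables `P` and the
agents `I`.  Up to the constructors defined below, this is the least set that contains the
variables, `⊤` and `⊥`, is closed under `∧`, `¬`, `K i` and `C`, and contains `⋁ Γ` and `⋀ Γ` for
each countable *set* `Γ` of its elements. -/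
def Formula (P I : Type*) : Type _ := Quotient (PreFormula.setoid P I)

namespace Formula

variable {P I : Type*}

/-- The formula given by a raw formula. -/
def mk (φ : PreFormula P I) : Formula P I := Quotient.mk _ φ

def var (p : P) : Formula P I := mk (.var p)

def top : Formula P I := mk .top

def bot : Formula P I := mk .bot

def and : Formula P I → Formula P I → Formula P I :=
  Quotient.map₂ PreFormula.and fun _ _ h _ _ k => PreFormula.Ext.and h k

def neg : Formula P I → Formula P I :=
  Quotient.map PreFormula.neg fun _ _ h => PreFormula.Ext.neg h

def box (m : Modality I) : Formula P I → Formula P I :=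
  Quotient.map (PreFormula.box m) fun _ _ h => PreFormula.Ext.box m h

theorem exists_enum {Γ : Set (Formula P I)} (hΓ : Γ.Countable) :
    ∃ (S : Set ℕ) (f : S → PreFormula P I), (Set.range fun s => mk (f s)) = Γ := by
  have := hΓ.to_subtype
  obtain ⟨e, he⟩ := exists_injective_nat Γ
  refine ⟨Set.range e, fun s => Quotient.out ((Equiv.ofInjective e he).symm s).1, ?_⟩
  ext φ
  constructor
  · rintro ⟨s, rfl⟩
    have : mk (Quotient.out ((Equiv.ofInjective e he).symm s).1)
      = ((Equiv.ofInjective e he).symm s).1 := Quotient.out_eq _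
    simp only [this]
    exact Subtype.prop _
  · intro h
    refine ⟨Equiv.ofInjective e he ⟨φ, h⟩, ?_⟩
    simp only [Equiv.symm_apply_apply]
    exact Quotient.out_eq φ

/-- The countable disjunction `⋁ Γ` of a countable set `Γ` of formulas. -/
noncomputable def ior (Γ : Set (Formula P I)) (hΓ : Γ.Countable) : Formula P I :=
  mk (.ior (exists_enum hΓ).choose (exists_enum hΓ).choose_spec.choose)

/-- The countable conjunction `⋀ Γ` of a countable set `Γ` of formulas. -/
noncomputable def iand (Γ : Set (Formula P I)) (hΓ : Γ.Countable) : Formula P I :=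
  mk (.iand (exists_enum hΓ).choose (exists_enum hΓ).choose_spec.choose)

theorem exists_maps_of_range_eq {S T : Set ℕ} {f : S → PreFormula P I} {g : T → PreFormula P I}
    (h : (Set.range fun s => mk (f s)) = Set.range fun t => mk (g t)) :
    ∃ (a : S → T) (b : T → S), (∀ s, PreFormula.Ext (f s) (g (a s))) ∧
      ∀ t, PreFormula.Ext (f (b t)) (g t) := by
  have h₁ : ∀ s, ∃ t, mk (g t) = mk (f s) := fun s => by
    have : mk (f s) ∈ Set.range fun t => mk (g t) := h ▸ ⟨s, rfl⟩
    exact this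
  have h₂ : ∀ t, ∃ s, mk (f s) = mk (g t) := fun t => by
    have : mk (g t) ∈ Set.range fun s => mk (f s) := h ▸ ⟨t, rfl⟩
    exact this
  choose a ha using h₁
  choose b hb using h₂
  exact ⟨a, b, fun s => Quotient.exact (ha s).symm, fun t => Quotient.exact (hb t)⟩

theorem mk_ior (S : Set ℕ) (f : S → PreFormula P I) :
    mk (.ior S f) = ior (Set.range fun s => mk (f s)) (Set.countable_range _) := by
  obtain ⟨a, b, h₁, h₂⟩ := exists_maps_of_range_eq
    (exists_enum (Set.countable_range fun s => mk (f s))).choose_spec.choose_spec.symm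
  exact Quotient.sound (.ior a b h₁ h₂)

theorem mk_iand (S : Set ℕ) (f : S → PreFormula P I) :
    mk (.iand S f) = iand (Set.range fun s => mk (f s)) (Set.countable_range _) := by
  obtain ⟨a, b, h₁, h₂⟩ := exists_maps_of_range_eq
    (exists_enum (Set.countable_range fun s => mk (f s))).choose_spec.choose_spec.symm
  exact Quotient.sound (.iand a b h₁ h₂)

/-- Structural induction on formulas. -/
theorem induction {motive : Formula P I → Prop}
    (var : ∀ p, motive (var p)) (top : motive top) (bot : motive bot)
    (and : ∀ φ ψ, motive φ → motive ψ → motive (and φ ψ))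
    (neg : ∀ φ, motive φ → motive (neg φ))
    (box : ∀ m φ, motive φ → motive (box m φ))
    (ior : ∀ Γ hΓ, (∀ γ ∈ Γ, motive γ) → motive (ior Γ hΓ))
    (iand : ∀ Γ hΓ, (∀ γ ∈ Γ, motive γ) → motive (iand Γ hΓ)) (φ : Formula P I) : motive φ := by
  refine Quotient.ind (fun φ => ?_) φ
  change motive (mk φ)
  induction φ with
  | var p => exact var p
  | top => exact top
  | bot => exact bot
  | and φ ψ h₁ h₂ => exact and _ _ h₁ h₂
  | neg φ h => exact neg _ h
  | box m φ h => exact box m _ h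
  | ior S f h => rw [mk_ior]; exact ior _ _ (by rintro _ ⟨s, rfl⟩; exact h s)
  | iand S f h => rw [mk_iand]; exact iand _ _ (by rintro _ ⟨s, rfl⟩; exact h s)

/-- `⋀ Γ` determines the set `Γ`. -/
theorem iand_injective {Γ Δ : Set (Formula P I)} {hΓ : Γ.Countable} {hΔ : Δ.Countable}
    (h : iand Γ hΓ = iand Δ hΔ) : Γ = Δ := by
  have e : PreFormula.Ext _ _ := Quotient.exact h
  rw [← (exists_enum hΓ).choose_spec.choose_spec, ← (exists_enum hΔ).choose_spec.choose_spec]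
  cases e with
  | iand a b h₁ h₂ =>
    ext φ
    constructor
    · rintro ⟨s, rfl⟩; exact ⟨a s, (Quotient.sound (h₁ s)).symm⟩
    · rintro ⟨t, rfl⟩; exact ⟨b t, Quotient.sound (h₂ t)⟩

/-- `⋁ Γ` determines the set `Γ`. -/
theorem ior_injective {Γ Δ : Set (Formula P I)} {hΓ : Γ.Countable} {hΔ : Δ.Countable}
    (h : ior Γ hΓ = ior Δ hΔ) : Γ = Δ := by
  have e : PreFormula.Ext _ _ := Quotient.exact h
  rw [← (exists_enum hΓ).choose_spec.choose_spec, ← (exists_enum hΔ).choose_spec.choose_spec]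
  cases e with
  | ior a b h₁ h₂ =>
    ext φ
    constructor
    · rintro ⟨s, rfl⟩; exact ⟨a s, (Quotient.sound (h₁ s)).symm⟩
    · rintro ⟨t, rfl⟩; exact ⟨b t, Quotient.sound (h₂ t)⟩

/-- The data for a definition by recursion on formulas, with values in `α`. -/
structure Clauses (P I α : Type*) where
  var : P → α
  top : α
  bot : α
  and : α → α → α
  neg : α → α
  box : Modality I → α → α
  ior : (s : Set α) → s.Countable → α
  iand : (s : Set α) → s.Countable → α

variable {α : Type*}

/-- Recursion on raw formulas. -/
def preFold (c : Clauses P I α) : PreFormula P I → α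
  | .var p => c.var p
  | .top => c.top
  | .bot => c.bot
  | .and φ ψ => c.and (preFold c φ) (preFold c ψ)
  | .neg φ => c.neg (preFold c φ)
  | .box m φ => c.box m (preFold c φ)
  | .ior S f => c.ior (Set.range fun s : S => preFold c (f s)) (Set.countable_range _)
  | .iand S f => c.iand (Set.range fun s : S => preFold c (f s)) (Set.countable_range _)

theorem preFold_eq (c : Clauses P I α) {φ ψ : PreFormula P I} (h : PreFormula.Ext φ ψ) :
    preFold c φ = preFold c ψ := by
  have key : ∀ {S T : Set ℕ} {f : S → PreFormula P I} {g : T → PreFormula P I}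
      (a : S → T) (b : T → S), (∀ s, preFold c (f s) = preFold c (g (a s))) →
      (∀ t, preFold c (f (b t)) = preFold c (g t)) →
      (Set.range fun s => preFold c (f s)) = Set.range fun t => preFold c (g t) := by
    intro S T f g a b h₁ h₂
    ext x
    constructor
    · rintro ⟨s, rfl⟩; exact ⟨a s, (h₁ s).symm⟩
    · rintro ⟨t, rfl⟩; exact ⟨b t, h₂ t⟩
  induction h with
  | var p => rfl
  | top => rfl
  | bot => rfl
  | and _ _ h₁ h₂ => simp only [preFold, h₁, h₂]
  | neg _ h => simp only [preFold, h]
  | box m _ h => simp only [preFold, h]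
  | ior a b _ _ h₁ h₂ => simp only [preFold, key a b h₁ h₂]
  | iand a b _ _ h₁ h₂ => simp only [preFold, key a b h₁ h₂]

/-- Recursion on formulas; the recursion equations are proved below. -/
def fold (c : Clauses P I α) : Formula P I → α :=
  Quotient.lift (preFold c) fun _ _ h => preFold_eq c h

theorem fold_var (c : Clauses P I α) (p : P) : fold c (var p) = c.var p := rfl

theorem fold_top (c : Clauses P I α) : fold c top = c.top := rfl

theorem fold_bot (c : Clauses P I α) : fold c bot = c.bot := rfl

theorem fold_and (c : Clauses P I α) (φ ψ : Formula P I) :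
    fold c (and φ ψ) = c.and (fold c φ) (fold c ψ) := Quotient.inductionOn₂ φ ψ fun _ _ => rfl

theorem fold_neg (c : Clauses P I α) (φ : Formula P I) : fold c (neg φ) = c.neg (fold c φ) :=
  Quotient.inductionOn φ fun _ => rfl

theorem fold_box (c : Clauses P I α) (m : Modality I) (φ : Formula P I) :
    fold c (box m φ) = c.box m (fold c φ) := Quotient.inductionOn φ fun _ => rfl

theorem fold_ior (c : Clauses P I α) (Γ : Set (Formula P I)) (hΓ : Γ.Countable) :
    fold c (ior Γ hΓ) = c.ior (fold c '' Γ) (hΓ.image _) := by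
  have h : fold c '' Γ = Set.range fun s => preFold c ((exists_enum hΓ).choose_spec.choose s) := by
    conv_lhs => rw [← (exists_enum hΓ).choose_spec.choose_spec]
    rw [← Set.range_comp]; rfl
  simp only [h]; rfl

theorem fold_iand (c : Clauses P I α) (Γ : Set (Formula P I)) (hΓ : Γ.Countable) :
    fold c (iand Γ hΓ) = c.iand (fold c '' Γ) (hΓ.image _) := by
  have h : fold c '' Γ = Set.range fun s => preFold c ((exists_enum hΓ).choose_spec.choose s) := by
    conv_lhs => rw [← (exists_enum hΓ).choose_spec.choose_spec]
    rw [← Set.range_comp]; rfl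
  simp only [h]; rfl

/-- `φ ∨ ψ` -/
def or (φ ψ : Formula P I) : Formula P I := neg (and (neg φ) (neg ψ))

/-- `φ ⊃ ψ` -/
def imp (φ ψ : Formula P I) : Formula P I := or (neg φ) ψ

/-- The finite conjunction of a list of formulas. -/
def conj : List (Formula P I) → Formula P I
  | [] => top
  | [φ] => φ
  | φ :: ψ :: l => and φ (conj (ψ :: l))

/-- `E φ`, the finite conjunction of all `K i φ` (in some fixed order of the agents). -/
noncomputable def E [Fintype I] (φ : Formula P I) : Formula P I :=
  conj ((Finset.univ : Finset I).toList.map fun i => box (.K i) φ)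

/-- Uniform substitution of the formulas `σ p` for the variables `p`. -/
noncomputable def subst (σ : P → Formula P I) : Formula P I → Formula P I :=
  fold { var := σ, top := top, bot := bot, and := and, neg := neg, box := box,
         ior := ior, iand := iand }

/-- Propositional tautologies: formulas that are true under every assignment of truth values to
formulas that respects `⊤`, `⊥`, `∧` and `¬`.  (Variables and the formulas of the form `K i φ`,
`C φ`, `⋁ Γ`, `⋀ Γ` play the role of propositional atoms.) -/
def IsTautology (φ : Formula P I) : Prop :=
  ∀ V : Formula P I → Prop, V top → ¬ V bot → (∀ ψ χ, V (and ψ χ) ↔ V ψ ∧ V χ) →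
    (∀ ψ, V (neg ψ) ↔ ¬ V ψ) → V φ

end Formula

/-! ## The proof system -/

open Formula in
/-- Provability in the infinitary Meyer–van der Hoek system. -/
inductive IPSMH {P I : Type*} [Fintype I] : Formula P I → Prop
  | taut {φ : Formula P I} : IsTautology φ → IPSMH φ
  | distr (m : Modality I) (φ ψ : Formula P I) :
      IPSMH (imp (box m (imp φ ψ)) (imp (box m φ) (box m ψ)))
  | c_refl (φ : Formula P I) : IPSMH (imp (box .C φ) φ)
  | c_mix (φ : Formula P I) : IPSMH (imp (box .C φ) (E (box .C φ)))
  | c_ind (φ : Formula P I) : IPSMH (imp (box .C (imp φ (E φ))) (imp φ (box .C φ)))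
  | barcan (m : Modality I) (Γ : Set (Formula P I)) (hΓ : Γ.Countable) :
      IPSMH (imp (iand (box m '' Γ) (hΓ.image _)) (box m (iand Γ hΓ)))
  | ior_intro (Γ : Set (Formula P I)) (hΓ : Γ.Countable) (γ : Formula P I) (hγ : γ ∈ Γ) :
      IPSMH (imp γ (ior Γ hΓ))
  | iand_elim (Γ : Set (Formula P I)) (hΓ : Γ.Countable) (γ : Formula P I) (hγ : γ ∈ Γ) :
      IPSMH (imp (iand Γ hΓ) γ)
  | mp {φ ψ : Formula P I} : IPSMH (imp φ ψ) → IPSMH φ → IPSMH ψ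
  | subst (σ : P → Formula P I) {φ : Formula P I} : IPSMH φ → IPSMH (φ.subst σ)
  | nec (m : Modality I) {φ : Formula P I} : IPSMH φ → IPSMH (box m φ)
  | ior_elim (Γ : Set (Formula P I)) (hΓ : Γ.Countable) (φ : Formula P I) :
      (∀ γ ∈ Γ, IPSMH (imp γ φ)) → IPSMH (imp (ior Γ hΓ) φ)
  | iand_intro (Γ : Set (Formula P I)) (hΓ : Γ.Countable) (φ : Formula P I) :
      (∀ γ ∈ Γ, IPSMH (imp φ γ)) → IPSMH (imp φ (iand Γ hΓ))

/-! ## Kripke semantics -/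

/-- Kripke frames: a non-empty set with a binary relation for each modal operator. -/
structure KripkeFrame (I : Type v) where
  W : Type w
  nonempty : Nonempty W
  R : Modality I → W → W → Prop

namespace KripkeFrame

variable {P : Type u} {I : Type v}

/-- The relation `R_E`, the union of the relations of the agents. -/
def RE (F : KripkeFrame.{v, w} I) (x y : F.W) : Prop := ∃ i, F.R (.K i) x y

/-- The extension of a valuation `v` of the variables to all formulas. -/
def val (F : KripkeFrame.{v, w} I) (v : P → Set F.W) : Formula P I → Set F.W :=
  Formula.fold
    { var := v
      top := Set.univ
      bot := ∅
      and := fun s t => s ∩ t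
      neg := fun s => sᶜ
      box := fun m s => {x | ∀ y, F.R m x y → y ∈ s}
      ior := fun A _ => ⋃₀ A
      iand := fun A _ => ⋂₀ A }

theorem val_var (F : KripkeFrame.{v, w} I) (v : P → Set F.W) (p : P) :
    F.val v (.var p) = v p := rfl

theorem val_top (F : KripkeFrame.{v, w} I) (v : P → Set F.W) :
    F.val v .top = Set.univ := rfl

theorem val_bot (F : KripkeFrame.{v, w} I) (v : P → Set F.W) :
    F.val v .bot = ∅ := rfl

theorem val_and (F : KripkeFrame.{v, w} I) (v : P → Set F.W) (φ ψ : Formula P I) :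
    F.val v (.and φ ψ) = F.val v φ ∩ F.val v ψ := Formula.fold_and _ _ _

theorem val_neg (F : KripkeFrame.{v, w} I) (v : P → Set F.W) (φ : Formula P I) :
    F.val v (.neg φ) = (F.val v φ)ᶜ := Formula.fold_neg _ _

theorem val_box (F : KripkeFrame.{v, w} I) (v : P → Set F.W) (m : Modality I)
    (φ : Formula P I) :
    F.val v (.box m φ) = {x | ∀ y, F.R m x y → y ∈ F.val v φ} := Formula.fold_box _ _ _

theorem val_ior (F : KripkeFrame.{v, w} I) (v : P → Set F.W) (Γ : Set (Formula P I))
    (hΓ : Γ.Countable) : F.val v (.ior Γ hΓ) = ⋃ γ ∈ Γ, F.val v γ := by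
  exact (Formula.fold_ior _ _ _).trans (Set.sUnion_image _ _)

theorem val_iand (F : KripkeFrame.{v, w} I) (v : P → Set F.W) (Γ : Set (Formula P I))
    (hΓ : Γ.Countable) : F.val v (.iand Γ hΓ) = ⋂ γ ∈ Γ, F.val v γ := by
  exact (Formula.fold_iand _ _ _).trans (Set.sInter_image _ _)

/-- Validity of a formula in a frame. -/
def Valid (F : KripkeFrame.{v, w} I) (φ : Formula P I) : Prop :=
  ∀ v : P → Set F.W, F.val v φ = Set.univ

end KripkeFrame

/-- The class of CKL-frames: `R_C` is the reflexive and transitive closure of `R_E`. -/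
def FrmCKL (I : Type v) : Set (KripkeFrame.{v, w} I) :=
  {F | ∀ x y, F.R .C x y ↔ Relation.ReflTransGen F.RE x y}

/-- Validity of a formula in a class of frames. -/
def ValidIn {P : Type u} {I : Type v} (𝓕 : Set (KripkeFrame.{v, w} I))
    (φ : Formula P I) : Prop :=
  ∀ F ∈ 𝓕, F.Valid φ

end CKL

namespace CKL

open Formula

/-! ## Soundness -/

section Soundness

variable {P : Type u} {I : Type v}

/-! Soundness is an induction on derivations. Completeness uses a canonical model relative to a
countable fragment `A`. The whole language may have uncountably many conjunctions, and a theory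
cannot be made to respect them all; countably many can be met one at a time, as in the
Rasiowa–Sikorski lemma. A world is a consistent theory that decides every formula of `A` and
contains each conjunction in `A` all of whose members it contains.

`IsCompleteTheory.exists_world` extends a theory to a world omitting a given formula of `A`,
provided the theory already respects the conjunctions of `A` under hypotheses from `A`. The set of
theorems does so by the infinitary rule. So does the set of `φ` with `box m φ` in a world, by the
Barcan axiom; this gives successors and hence the modal truth lemma for the agents.

For `C`, the canonical relation is taken to be the reflexive transitive closure, so the frame is a
CKL-frame by construction. The truth lemma then rests on `IPSMH.iand_iterE_imp_C`: the conjunction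
of all `E^[n] φ` implies `box .C φ`, which follows from the induction axiom once Barcan shows that
this conjunction implies its own `E`. -/

theorem KripkeFrame.mem_val_imp (F : KripkeFrame.{v, w} I) (v : P → Set F.W) (φ ψ : Formula P I)
    (x : F.W) : x ∈ F.val v (imp φ ψ) ↔ (x ∈ F.val v φ → x ∈ F.val v ψ) := by
  simp only [imp, Formula.or, KripkeFrame.val_neg, KripkeFrame.val_and, Set.mem_compl_iff, Set.mem_inter_iff]
  tauto

theorem KripkeFrame.mem_val_conj (F : KripkeFrame.{v, w} I) (v : P → Set F.W) (x : F.W) :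
    ∀ l : List (Formula P I), x ∈ F.val v (conj l) ↔ ∀ φ ∈ l, x ∈ F.val v φ
  | [] => by simp [conj, KripkeFrame.val_top]
  | [φ] => by simp [conj]
  | φ :: ψ :: l => by
    rw [conj, KripkeFrame.val_and, Set.mem_inter_iff, KripkeFrame.mem_val_conj F v x (ψ :: l),
      List.forall_mem_cons (a := φ)]

theorem KripkeFrame.mem_val_E [Fintype I] (F : KripkeFrame.{v, w} I) (v : P → Set F.W)
    (φ : Formula P I) (x : F.W) :
    x ∈ F.val v (E φ) ↔ ∀ y, F.RE x y → y ∈ F.val v φ := by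
  simp only [E, KripkeFrame.mem_val_conj, List.mem_map, Finset.mem_toList, Finset.mem_univ,
    true_and, forall_exists_index, forall_apply_eq_imp_iff, KripkeFrame.val_box, Set.mem_ofPred_eq,
    KripkeFrame.RE]
  exact forall_comm

theorem KripkeFrame.val_subst (F : KripkeFrame.{v, w} I) (v : P → Set F.W) (σ : P → Formula P I)
    (φ : Formula P I) : F.val v (φ.subst σ) = F.val (fun p => F.val v (σ p)) φ := by
  induction φ using Formula.induction with
  | var p => rfl
  | top => rfl
  | bot => rfl
  | and φ ψ h k => rw [KripkeFrame.val_and, ← h, ← k, ← KripkeFrame.val_and]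
                   exact congrArg _ (fold_and _ _ _)
  | neg φ h => rw [KripkeFrame.val_neg, ← h, ← KripkeFrame.val_neg]
               exact congrArg _ (fold_neg _ _)
  | box m φ h => rw [KripkeFrame.val_box, ← h, ← KripkeFrame.val_box]
                 exact congrArg _ (fold_box _ _ _)
  | ior Γ hΓ h =>
    rw [KripkeFrame.val_ior, ← Set.iUnion₂_congr h]
    refine (congrArg _ (fold_ior _ _ _)).trans ?_
    rw [KripkeFrame.val_ior, Set.biUnion_image]
    rfl
  | iand Γ hΓ h =>
    rw [KripkeFrame.val_iand, ← Set.iInter₂_congr h]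
    refine (congrArg _ (fold_iand _ _ _)).trans ?_
    rw [KripkeFrame.val_iand, Set.biInter_image]
    rfl

/-- The induction must range over all valuations, since the substitution rule changes the valuation,
and over all points, because of necessitation. -/
theorem IPSMH.sound [Fintype I] {φ : Formula P I} (h : IPSMH φ) (F : KripkeFrame.{v, w} I)
    (hF : F ∈ FrmCKL I) (v : P → Set F.W) (x : F.W) : x ∈ F.val v φ := by
  induction h generalizing v x with
  | taut h =>
    refine h (fun ψ => x ∈ F.val v ψ) trivial id (fun ψ χ => ?_) fun ψ => ?_
    · rw [KripkeFrame.val_and]; rfl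
    · rw [KripkeFrame.val_neg]; rfl
  | distr m φ ψ =>
    simp only [KripkeFrame.mem_val_imp, KripkeFrame.val_box, Set.mem_ofPred_eq]
    exact fun h k y hy => h y hy (k y hy)
  | c_refl φ =>
    rw [KripkeFrame.mem_val_imp, KripkeFrame.val_box]
    exact fun h => h x ((hF x x).2 .refl)
  | c_mix φ =>
    rw [KripkeFrame.mem_val_imp, KripkeFrame.mem_val_E, KripkeFrame.val_box]
    exact fun h y hy z hz => h z ((hF x z).2 (.head hy ((hF y z).1 hz)))
  | c_ind φ =>
    simp only [KripkeFrame.mem_val_imp, KripkeFrame.val_box, Set.mem_ofPred_eq,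
      KripkeFrame.mem_val_E]
    intro h hx y hy
    have hy := (hF x y).1 hy
    induction hy with
    | refl => exact hx
    -- The earlier hypothesis on `R .C` depends on the endpoint, so it returns as a premise of `ih`.
    | tail h₁ h₂ ih => exact h _ ((hF _ _).2 h₁) (ih ((hF _ _).2 h₁)) _ h₂
  | barcan m Γ hΓ =>
    simp only [KripkeFrame.mem_val_imp, KripkeFrame.val_box, Set.mem_ofPred_eq,
      KripkeFrame.val_iand, Set.mem_iInter, Set.forall_mem_image]
    exact fun h y hy γ hγ => h hγ y hy
  | ior_intro Γ hΓ γ hγ =>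
    rw [KripkeFrame.mem_val_imp, KripkeFrame.val_ior]
    exact fun h => Set.mem_biUnion hγ h
  | iand_elim Γ hΓ γ hγ =>
    rw [KripkeFrame.mem_val_imp, KripkeFrame.val_iand]
    exact fun h => Set.mem_iInter₂.1 h γ hγ
  | mp _ _ h k => exact (KripkeFrame.mem_val_imp ..).1 (h v x) (k v x)
  | subst σ _ h => rw [KripkeFrame.val_subst]; exact h _ _
  | nec m _ h => rw [KripkeFrame.val_box]; exact fun y _ => h v y
  | ior_elim Γ hΓ φ _ h =>
    rw [KripkeFrame.mem_val_imp, KripkeFrame.val_ior]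
    intro hx
    obtain ⟨γ, hγ, hx⟩ := Set.mem_iUnion₂.1 hx
    exact (KripkeFrame.mem_val_imp ..).1 (h γ hγ v x) hx
  | iand_intro Γ hΓ φ _ h =>
    rw [KripkeFrame.mem_val_imp, KripkeFrame.val_iand]
    exact fun hx => Set.mem_iInter₂.2 fun γ hγ => (KripkeFrame.mem_val_imp ..).1 (h γ hγ v x) hx

end Soundness

/-! ## Derivations -/

section Derivations

variable {P I : Type*}

theorem Formula.IsTautology.of_forall {φ : Formula P I}
    (h : ∀ V : Formula P I → Prop, V top → ¬ V bot → (∀ ψ χ, V (and ψ χ) ↔ V ψ ∧ V χ) →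
      (∀ ψ, V (neg ψ) ↔ ¬ V ψ) → (∀ ψ χ, V (imp ψ χ) ↔ (V ψ → V χ)) → V φ) :
    IsTautology φ := by
  intro V ht hb ha hn
  refine h V ht hb ha hn fun ψ χ => ?_
  simp only [imp, Formula.or, ha, hn]
  tauto

/-- Sets of formulas that contain all theorems and are closed under modus ponens. -/
structure IsTheory [Fintype I] (u : Set (Formula P I)) : Prop where
  of_provable : ∀ {φ}, IPSMH φ → φ ∈ u
  mp : ∀ {φ ψ}, imp φ ψ ∈ u → φ ∈ u → ψ ∈ u

variable [Fintype I]

theorem IsTheory.provable : IsTheory {φ : Formula P I | IPSMH φ} := ⟨id, .mp⟩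

theorem IsTheory.taut {u : Set (Formula P I)} (hu : IsTheory u) {φ : Formula P I}
    (h : ∀ V : Formula P I → Prop, V top → ¬ V bot → (∀ ψ χ, V (and ψ χ) ↔ V ψ ∧ V χ) →
      (∀ ψ, V (neg ψ) ↔ ¬ V ψ) → (∀ ψ χ, V (imp ψ χ) ↔ (V ψ → V χ)) → V φ) : φ ∈ u :=
  hu.of_provable (.taut (.of_forall h))

theorem IsTheory.imp_trans {u : Set (Formula P I)} (hu : IsTheory u) {φ ψ χ : Formula P I}
    (h : imp φ ψ ∈ u) (k : imp ψ χ ∈ u) : imp φ χ ∈ u := by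
  refine hu.mp (hu.mp (hu.taut ?_) h) k
  intro V _ _ _ _ hi
  simp only [hi]
  tauto

theorem IsTheory.imp_of_mem {u : Set (Formula P I)} (hu : IsTheory u) {φ ψ : Formula P I}
    (h : φ ∈ u) : imp ψ φ ∈ u := by
  refine hu.mp (hu.taut ?_) h
  intro V _ _ _ _ hi
  simp only [hi]
  tauto

theorem IPSMH.imp_trans {φ ψ χ : Formula P I} (h : IPSMH (imp φ ψ)) (k : IPSMH (imp ψ χ)) :
    IPSMH (imp φ χ) := IsTheory.provable.imp_trans h k

theorem IPSMH.box_mono (m : Modality I) {φ ψ : Formula P I} (h : IPSMH (imp φ ψ)) :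
    IPSMH (imp (box m φ) (box m ψ)) := .mp (.distr m φ ψ) (.nec m h)

theorem IPSMH.imp_conj {φ : Formula P I} : ∀ {l : List (Formula P I)},
    (∀ ψ ∈ l, IPSMH (imp φ ψ)) → IPSMH (imp φ (conj l))
  | [], _ => IsTheory.provable.taut fun V ht _ _ _ hi => (hi _ _).2 fun _ => ht
  | [ψ], h => h ψ (by simp)
  | ψ :: χ :: l, h => by
    rw [List.forall_mem_cons] at h
    refine .mp (.mp (IsTheory.provable.taut ?_) h.1) (IPSMH.imp_conj h.2)
    intro V _ _ ha _ hi
    simp only [hi, conj, ha]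
    tauto

theorem IPSMH.conj_imp : ∀ {l : List (Formula P I)} {φ : Formula P I}, φ ∈ l →
    IPSMH (imp (conj l) φ)
  | [ψ], φ, h => by
    obtain rfl := List.mem_singleton.1 h
    exact IsTheory.provable.taut fun V _ _ _ _ hi => (hi _ _).2 id
  | ψ :: χ :: l, φ, h => by
    rcases List.mem_cons.1 h with rfl | h
    · exact IsTheory.provable.taut fun V _ _ ha _ hi => (hi _ _).2 fun h => ((ha _ _).1 h).1
    · exact .imp_trans
        (IsTheory.provable.taut fun V _ _ ha _ hi => (hi _ _).2 fun h => ((ha _ _).1 h).2)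
        (IPSMH.conj_imp h)

theorem IPSMH.imp_E {φ ψ : Formula P I} (h : ∀ i, IPSMH (imp φ (box (.K i) ψ))) :
    IPSMH (imp φ (E ψ)) := by
  refine .imp_conj fun χ hχ => ?_
  obtain ⟨i, -, rfl⟩ := List.mem_map.1 hχ
  exact h i

theorem IPSMH.E_imp (φ : Formula P I) (i : I) : IPSMH (imp (E φ) (box (.K i) φ)) :=
  .conj_imp (List.mem_map.2 ⟨i, by simp, rfl⟩)

theorem IsTheory.E_mem {u : Set (Formula P I)} (hu : IsTheory u) {φ : Formula P I}
    (h : ∀ i, box (.K i) φ ∈ u) : E φ ∈ u := by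
  have key : ∀ l : List (Formula P I), (∀ ψ ∈ l, ψ ∈ u) → conj l ∈ u := by
    intro l
    induction l with
    | nil => exact fun _ => hu.taut fun V ht _ _ _ _ => ht
    | cons ψ l ih =>
      intro h
      rw [List.forall_mem_cons] at h
      cases l with
      | nil => exact h.1
      | cons χ l =>
        refine hu.mp (hu.mp (hu.taut ?_) h.1) (ih h.2)
        intro V _ _ ha _ hi
        simp only [hi, conj, ha]
        tauto
  refine key _ fun χ hχ => ?_
  obtain ⟨i, -, rfl⟩ := List.mem_map.1 hχ
  exact h i

/-- The set of all `E ⋯ E φ`. -/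
def iterE (φ : Formula P I) : Set (Formula P I) := Set.range fun n : ℕ => E^[n] φ

theorem iterE_countable (φ : Formula P I) : (iterE φ).Countable := Set.countable_range _

/-- The conjunction `ψ` is a post-fixed point of `E`: it contains `E^[n + 1] φ`, hence yields each
`box (.K i) (E^[n] φ)`, and Barcan collects these into `box (.K i) ψ`. Necessitation and the
induction axiom give `box .C ψ`, and `φ` is the member with `n = 0`. -/
theorem IPSMH.iand_iterE_imp_C (φ : Formula P I) :
    IPSMH (imp (iand (iterE φ) (iterE_countable φ)) (box .C φ)) := by
  set ψ := iand (iterE φ) (iterE_countable φ) with hψ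
  have hE : IPSMH (imp ψ (E ψ)) := by
    refine .imp_E fun i => .imp_trans (.iand_intro _ ((iterE_countable φ).image _) _ ?_)
      (.barcan (.K i) (iterE φ) (iterE_countable φ))
    rintro _ ⟨_, ⟨n, rfl⟩, rfl⟩
    refine .imp_trans (.iand_elim _ _ (E^[n + 1] φ) ⟨n + 1, rfl⟩) ?_
    rw [Function.iterate_succ_apply']
    exact .E_imp _ i
  exact .imp_trans (.mp (.c_ind ψ) (.nec .C hE)) (.box_mono .C (.iand_elim _ _ φ ⟨0, rfl⟩))

/-- Used under a box: Barcan delivers a boxed conjunction of implications, whereas complete theories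
ask for an implication into a conjunction. -/
theorem IPSMH.iand_imp_imp (ψ : Formula P I) (Γ : Set (Formula P I)) (hΓ : Γ.Countable) :
    IPSMH (imp (iand (imp ψ '' Γ) (hΓ.image _)) (imp ψ (iand Γ hΓ))) := by
  have h : IPSMH (imp (and (iand (imp ψ '' Γ) (hΓ.image _)) ψ) (iand Γ hΓ)) := by
    refine .iand_intro _ _ _ fun γ hγ => ?_
    refine .mp (IsTheory.provable.taut ?_)
      (.iand_elim (imp ψ '' Γ) (hΓ.image _) _ (Set.mem_image_of_mem _ hγ))
    intro V _ _ ha _ hi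
    simp only [hi, ha]
    tauto
  refine .mp (IsTheory.provable.taut ?_) h
  intro V _ _ ha _ hi
  simp only [hi, ha]
  tauto

theorem IPSMH.ior_imp_neg_iand (Γ : Set (Formula P I)) (hΓ : Γ.Countable) :
    IPSMH (imp (ior Γ hΓ) (neg (iand (neg '' Γ) (hΓ.image _)))) := by
  refine .ior_elim _ _ _ fun γ hγ => ?_
  refine .mp (IsTheory.provable.taut ?_)
    (.iand_elim (neg '' Γ) (hΓ.image _) _ (Set.mem_image_of_mem _ hγ))
  intro V _ _ _ hn hi
  simp only [hi, hn]
  tauto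

end Derivations

/-! ## Countable fragments -/

section Fragments

variable {P I : Type*}

instance [Countable I] : Countable (Modality I) :=
  Function.Surjective.countable (f := fun o : Option I => o.elim Modality.C Modality.K) fun
    | .K i => ⟨some i, rfl⟩
    | .C => ⟨none, rfl⟩

/-- Sets of formulas closed under `¬`, `∧`, members of conjunctions, and the conjunctions needed to
apply the Barcan axiom to implications. -/
structure IsFragment (A : Set (Formula P I)) : Prop where
  neg : ∀ {φ}, φ ∈ A → neg φ ∈ A
  and : ∀ {φ ψ}, φ ∈ A → ψ ∈ A → and φ ψ ∈ A
  mem : ∀ {Γ hΓ γ}, iand Γ hΓ ∈ A → γ ∈ Γ → γ ∈ A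
  barcan : ∀ (m) {Γ hΓ ψ}, iand Γ hΓ ∈ A → ψ ∈ A →
    iand (box m '' (imp ψ '' Γ)) ((hΓ.image _).image _) ∈ A

/-- Countably many rounds suffice: two elements of the union already lie in a common stage, so their
values enter at the next. -/
theorem exists_countable_closure {α : Type*} (f : α → α → Set α) (hf : ∀ a b, (f a b).Countable)
    {B : Set α} (hB : B.Countable) :
    ∃ A, B ⊆ A ∧ A.Countable ∧ ∀ a ∈ A, ∀ b ∈ A, f a b ⊆ A := by
  let s : ℕ → Set α := fun n => (fun A => A ∪ ⋃ a ∈ A, ⋃ b ∈ A, f a b)^[n] B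
  have hs : ∀ n, s (n + 1) = s n ∪ ⋃ a ∈ s n, ⋃ b ∈ s n, f a b := fun n =>
    Function.iterate_succ_apply' _ _ _
  have hmono : Monotone s := monotone_nat_of_le_succ fun n => by
    rw [hs]; exact Set.subset_union_left
  refine ⟨⋃ n, s n, Set.subset_iUnion s 0, Set.countable_iUnion fun n => ?_, ?_⟩
  · induction n with
    | zero => exact hB
    | succ n ih =>
      rw [hs]
      exact ih.union (ih.biUnion fun a _ => ih.biUnion fun b _ => hf a b)
  · intro a ha b hb c hc
    obtain ⟨k, ha⟩ := Set.mem_iUnion.1 ha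
    obtain ⟨l, hb⟩ := Set.mem_iUnion.1 hb
    refine Set.mem_iUnion.2 ⟨max k l + 1, ?_⟩
    rw [hs]
    exact Or.inr (Set.mem_biUnion (hmono (le_max_left k l) ha)
      (Set.mem_biUnion (hmono (le_max_right k l) hb) hc))

theorem exists_fragment [Countable I] {B : Set (Formula P I)} (hB : B.Countable) :
    ∃ A, B ⊆ A ∧ A.Countable ∧ IsFragment A := by
  let g : Formula P I → Formula P I → Set (Formula P I) := fun φ ψ =>
    {χ | ∃ Γ hΓ, φ = iand Γ hΓ ∧
      (χ ∈ Γ ∨ ∃ m, iand (box m '' (imp ψ '' Γ)) ((hΓ.image _).image _) = χ)}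
  have hg : ∀ φ ψ, (g φ ψ).Countable := by
    intro φ ψ
    by_cases h : ∃ Γ hΓ, φ = iand Γ hΓ
    · obtain ⟨Γ, hΓ, rfl⟩ := h
      refine (hΓ.union (Set.countable_range fun m : Modality I =>
        iand (box m '' (imp ψ '' Γ)) ((hΓ.image _).image _))).mono ?_
      rintro χ ⟨Δ, hΔ, h, h'⟩
      -- A conjunction determines its set of members, so only one `Γ` contributes and `g φ ψ` stays
      -- countable.
      obtain rfl := iand_injective h
      exact h'
    · convert Set.countable_empty
      exact Set.eq_empty_of_forall_notMem fun χ ⟨Γ, hΓ, h', _⟩ => h ⟨Γ, hΓ, h'⟩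
  obtain ⟨A, hBA, hA, hcl⟩ := exists_countable_closure
    (fun φ ψ => {neg φ, and φ ψ} ∪ g φ ψ)
    (fun φ ψ => ((Set.countable_singleton _).insert _).union (hg φ ψ)) hB
  exact ⟨A, hBA, hA,
    { neg := fun {φ} h => hcl φ h φ h (Or.inl (Or.inl rfl))
      and := fun {φ ψ} h k => hcl φ h ψ k (Or.inl (Or.inr rfl))
      mem := fun {Γ hΓ γ} h k => hcl _ h _ h (Or.inr ⟨Γ, hΓ, rfl, Or.inl k⟩)
      barcan := fun m {Γ hΓ ψ} h k => hcl _ h _ k (Or.inr ⟨Γ, hΓ, rfl, Or.inr ⟨m, rfl⟩⟩) }⟩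

end Fragments

/-! ## Worlds of the canonical model -/

section Worlds

variable {P I : Type*} [Fintype I]

/-- Theories that respect the conjunctions of `A` under implications from formulas of `A`. -/
structure IsCompleteTheory (A F : Set (Formula P I)) : Prop extends IsTheory F where
  iand : ∀ {ψ Γ hΓ}, ψ ∈ A → iand Γ hΓ ∈ A → (∀ γ ∈ Γ, imp ψ γ ∈ F) → imp ψ (iand Γ hΓ) ∈ F

/-- Consistent theories that decide the formulas of `A` and respect its conjunctions. -/
structure IsWorld (A u : Set (Formula P I)) : Prop extends IsTheory u where
  bot : bot ∉ u
  dec : ∀ {φ}, φ ∈ A → φ ∈ u ∨ neg φ ∈ u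
  iand : ∀ {Γ hΓ}, iand Γ hΓ ∈ A → (∀ γ ∈ Γ, γ ∈ u) → iand Γ hΓ ∈ u

theorem IsCompleteTheory.provable (A : Set (Formula P I)) :
    IsCompleteTheory A {φ | IPSMH φ} where
  toIsTheory := .provable
  iand _ _ h := .iand_intro _ _ _ h

theorem IsTheory.neg_mem_of_imp {u : Set (Formula P I)} (hu : IsTheory u) {φ ψ : Formula P I}
    (h : imp φ ψ ∈ u) (k : imp φ (neg ψ) ∈ u) : neg φ ∈ u := by
  refine hu.mp (hu.mp (hu.taut ?_) h) k
  intro V _ _ _ hn hi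
  simp only [hi, hn]
  tauto

theorem IsWorld.neg_mem_iff {A u : Set (Formula P I)} (hu : IsWorld A u) {φ : Formula P I}
    (h : φ ∈ A) : neg φ ∈ u ↔ φ ∉ u := by
  refine ⟨fun hn hp => hu.bot (hu.mp (hu.mp (hu.taut ?_) hn) hp), fun hp => (hu.dec h).resolve_left hp⟩
  intro V _ _ _ hn hi
  simp only [hi, hn]
  tauto

theorem IsTheory.and_mem_iff {u : Set (Formula P I)} (hu : IsTheory u) {φ ψ : Formula P I} :
    and φ ψ ∈ u ↔ φ ∈ u ∧ ψ ∈ u := by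
  refine ⟨fun h => ⟨hu.mp (hu.taut ?_) h, hu.mp (hu.taut ?_) h⟩,
    fun h => hu.mp (hu.mp (hu.taut ?_) h.1) h.2⟩ <;>
  · intro V _ _ ha _ hi
    simp only [hi, ha]
    tauto

/-- A formula of `A` consistent with `F` can be strengthened so as to decide `χ`, with a
counterexample if `χ` is a refuted conjunction. -/
theorem IsCompleteTheory.exists_decide {A F : Set (Formula P I)} (hA : IsFragment A)
    (hF : IsCompleteTheory A F) {ψ χ : Formula P I} (hψ : ψ ∈ A) (hc : neg ψ ∉ F) (hχ : χ ∈ A) :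
    ∃ θ ∈ A, neg θ ∉ F ∧ imp θ ψ ∈ F ∧ (imp θ χ ∈ F ∨ imp θ (neg χ) ∈ F ∧
      ∀ Γ hΓ, χ = Formula.iand Γ hΓ → ∃ γ ∈ Γ, imp θ (neg γ) ∈ F) := by
  have hl : ∀ φ, imp (and ψ φ) ψ ∈ F := fun φ =>
    hF.taut fun V _ _ ha _ hi => (hi _ _).2 fun h => ((ha _ _).1 h).1
  have hr : ∀ φ, imp (and ψ φ) φ ∈ F := fun φ =>
    hF.taut fun V _ _ ha _ hi => (hi _ _).2 fun h => ((ha _ _).1 h).2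
  -- If `ψ` is inconsistent with `neg φ`, then `ψ` itself already decides `φ` positively.
  have hcon : ∀ φ, neg (and ψ (neg φ)) ∈ F → imp ψ φ ∈ F := fun φ h => by
    refine hF.mp (hF.taut ?_) h
    intro V _ _ ha hn hi
    simp only [hi, ha, hn]
    tauto
  by_cases h₁ : neg (and ψ (neg χ)) ∈ F
  · exact ⟨ψ, hψ, hc, hF.taut fun V _ _ _ _ hi => (hi _ _).2 id, Or.inl (hcon χ h₁)⟩
  by_cases h₂ : ∃ Γ hΓ, χ = Formula.iand Γ hΓ
  · obtain ⟨Γ, hΓ, rfl⟩ := h₂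
    -- Otherwise `ψ` implies every member of `Γ` over `F`, hence their conjunction by completeness
    -- of `F`, against `h₁`.
    have : ∃ γ ∈ Γ, neg (and ψ (neg γ)) ∉ F := by
      by_contra! h
      have h' := hF.iand hψ hχ fun γ hγ => hcon γ (h γ hγ)
      refine h₁ (hF.mp (hF.taut ?_) h')
      intro V _ _ ha hn hi
      simp only [hi, ha, hn]
      tauto
    obtain ⟨γ, hγ, h⟩ := this
    refine ⟨and ψ (neg γ), hA.and hψ (hA.neg (hA.mem hχ hγ)), h, hl _, Or.inr ⟨?_, ?_⟩⟩
    · refine hF.imp_trans (hr (neg γ)) (hF.mp (hF.taut ?_) (hF.of_provable (.iand_elim Γ hΓ γ hγ)))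
      intro V _ _ _ hn hi
      simp only [hi, hn]
      tauto
    · intro Δ hΔ h
      obtain rfl := iand_injective h
      exact ⟨γ, hγ, hr _⟩
  · exact ⟨and ψ (neg χ), hA.and hψ (hA.neg hχ), h₁, hl _, Or.inr ⟨hr _,
      fun Γ hΓ h => (h₂ ⟨Γ, hΓ, h⟩).elim⟩⟩

/-- A Rasiowa–Sikorski argument. By `exists_decide`, the conditions deciding a given formula of `A`
are cofinal; an ideal containing `neg φ` and meeting these countably many cofinal sets generates the
world. -/
theorem IsCompleteTheory.exists_world {A F : Set (Formula P I)} (hA : IsFragment A)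
    (hc : A.Countable) (hF : IsCompleteTheory A F) {φ : Formula P I} (hφ : φ ∈ A) (h : φ ∉ F) :
    ∃ u, IsWorld A u ∧ F ⊆ u ∧ φ ∉ u := by
  let Q := {ψ : Formula P I // ψ ∈ A ∧ neg ψ ∉ F}
  let _ : Preorder Q :=
    -- Larger means stronger, so ideals here play the role of filters of formulas.
    { le := fun a b => imp b.1 a.1 ∈ F
      le_refl := fun a => hF.taut fun V _ _ _ _ hi => (hi _ _).2 id
      le_trans := fun a b c hab hbc => hF.imp_trans hbc hab }
  have hle : ∀ {a b : Q}, a ≤ b ↔ imp b.1 a.1 ∈ F := Iff.rfl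
  have hq : neg (neg φ) ∉ F := fun k => h (hF.mp (hF.taut fun V _ _ _ hn hi => by
    simp only [hi, hn]; tauto) k)
  let q : Q := ⟨neg φ, hA.neg hφ, hq⟩
  have : Countable A := hc
  let _ : Encodable A := Encodable.ofCountable A
  let 𝒟 : A → Order.Cofinal Q := fun χ =>
    { carrier := {θ | imp θ.1 χ.1 ∈ F ∨ imp θ.1 (neg χ) ∈ F ∧
        ∀ Γ hΓ, χ.1 = Formula.iand Γ hΓ → ∃ γ ∈ Γ, imp θ.1 (neg γ) ∈ F}
      isCofinal := fun ψ => by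
        obtain ⟨θ, hθ, hcon, hψ, hd⟩ := hF.exists_decide hA ψ.2.1 ψ.2.2 χ.2
        exact ⟨⟨θ, hθ, hcon⟩, hd, hψ⟩ }
  let J := Order.idealOfCofinals q 𝒟
  have hJ : ∀ χ ∈ A, ∃ θ ∈ J, imp θ.1 χ ∈ F ∨ imp θ.1 (neg χ) ∈ F ∧
      ∀ Γ hΓ, χ = Formula.iand Γ hΓ → ∃ γ ∈ Γ, imp θ.1 (neg γ) ∈ F := fun χ hχ => by
    obtain ⟨θ, h₁, h₂⟩ := Order.cofinal_meets_idealOfCofinals q 𝒟 ⟨χ, hχ⟩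
    exact ⟨θ, h₂, h₁⟩
  have hqJ : q ∈ J := Order.mem_idealOfCofinals q 𝒟
  have hcons : ∀ χ, (∃ θ ∈ J, imp θ.1 χ ∈ F) → (∃ θ ∈ J, imp θ.1 (neg χ) ∈ F) → False := by
    rintro χ ⟨a, ha, h₁⟩ ⟨b, hb, h₂⟩
    obtain ⟨c, -, hac, hbc⟩ := J.directed a ha b hb
    -- A common strengthening `c` would imply both `χ` and its negation, although every condition is
    -- consistent with `F`.
    exact c.2.2 (hF.neg_mem_of_imp (hF.imp_trans (hle.1 hac) h₁) (hF.imp_trans (hle.1 hbc) h₂))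
  refine ⟨{χ | ∃ θ ∈ J, imp θ.1 χ ∈ F},
    { of_provable := fun h => ⟨q, hqJ, hF.imp_of_mem (hF.of_provable h)⟩
      mp := ?_
      bot := fun h => hcons _ h ⟨q, hqJ, hF.imp_of_mem
        (hF.taut fun V _ hb _ hn _ => (hn _).2 hb)⟩
      dec := ?_
      iand := ?_ }, fun χ hχ => ⟨q, hqJ, hF.imp_of_mem hχ⟩, fun h => hcons _ h
        ⟨q, hqJ, hF.taut fun V _ _ _ _ hi => (hi _ _).2 id⟩⟩
  · rintro χ ψ ⟨a, ha, h₁⟩ ⟨b, hb, h₂⟩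
    obtain ⟨c, hcJ, hac, hbc⟩ := J.directed a ha b hb
    refine ⟨c, hcJ, hF.mp (hF.mp (hF.taut ?_) (hF.imp_trans (hle.1 hac) h₁))
      (hF.imp_trans (hle.1 hbc) h₂)⟩
    intro V _ _ _ _ hi
    simp only [hi]
    tauto
  · intro χ hχ
    obtain ⟨θ, hθ, hd⟩ := hJ χ hχ
    exact hd.imp (fun h => ⟨θ, hθ, h⟩) fun h => ⟨θ, hθ, h.1⟩
  · intro Γ hΓ hχ hall
    obtain ⟨θ, hθ, hd⟩ := hJ _ hχ
    refine ⟨θ, hθ, hd.resolve_right fun ⟨_, hd⟩ => ?_⟩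
    -- A refuted conjunction comes with a refuted member, which contradicts that all members are in
    -- the world.
    obtain ⟨γ, hγ, hd⟩ := hd Γ hΓ rfl
    exact hcons γ (hall γ hγ) ⟨θ, hθ, hd⟩

/-- The closure condition `IsFragment.barcan` exists for this: it lets `u` gather all `box m (imp ψ
γ)` into one conjunction, which Barcan turns into a boxed one. -/
theorem IsWorld.isCompleteTheory_box {A u : Set (Formula P I)} (hA : IsFragment A)
    (hu : IsWorld A u) (m : Modality I) : IsCompleteTheory A {φ | box m φ ∈ u} where
  of_provable h := hu.of_provable (.nec m h)
  mp h k := hu.mp (hu.mp (hu.of_provable (.distr m _ _)) h) k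
  iand {ψ Γ hΓ} hψ hχ h := by
    have h₁ : Formula.iand (box m '' (imp ψ '' Γ)) ((hΓ.image _).image _) ∈ u := by
      refine hu.iand (hA.barcan m hχ hψ) ?_
      rintro _ ⟨_, ⟨γ, hγ, rfl⟩, rfl⟩
      exact h γ hγ
    exact hu.mp (hu.of_provable (.box_mono m (.iand_imp_imp ψ Γ hΓ)))
      (hu.mp (hu.of_provable (.barcan m _ (hΓ.image _))) h₁)

theorem IsWorld.exists_successor {A u : Set (Formula P I)} (hA : IsFragment A) (hc : A.Countable)
    (hu : IsWorld A u) (m : Modality I) {φ : Formula P I} (hφ : φ ∈ A) (h : box m φ ∉ u) :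
    ∃ t, IsWorld A t ∧ (∀ ψ, box m ψ ∈ u → ψ ∈ t) ∧ φ ∉ t :=
  (hu.isCompleteTheory_box hA m).exists_world hA hc hφ h

end Worlds

/-! ## The canonical model -/

section CanonicalModel

variable {P : Type u} {I : Type v} [Fintype I]

/-- Codes of the worlds of the fragment enumerated by `e`: the sets of indices of the formulas of
the fragment that hold in some world. -/
def WorldCode (e : ℕ → Formula P I) : Type w :=
  ULift.{w} {s : Set ℕ // ∃ u, IsWorld (Set.range e) u ∧ e ⁻¹' u = s}

namespace WorldCode

variable {e : ℕ → Formula P I}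

/-- A world with the given code. -/
noncomputable def world (x : WorldCode.{u, v, w} e) : Set (Formula P I) := x.down.2.choose

theorem isWorld (x : WorldCode.{u, v, w} e) : IsWorld (Set.range e) x.world :=
  x.down.2.choose_spec.1

/-- Codes are lifted sets of naturals, so the frame fits in any universe, whatever the universes of
variables and agents. The chosen world may differ from `u`, but only outside the fragment. -/
theorem exists_code {u : Set (Formula P I)} (hu : IsWorld (Set.range e) u) :
    ∃ x : WorldCode.{u, v, w} e, ∀ φ ∈ Set.range e, φ ∈ x.world ↔ φ ∈ u := by
  let x : WorldCode.{u, v, w} e := ⟨⟨e ⁻¹' u, u, hu, rfl⟩⟩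
  have hx : e ⁻¹' x.world = e ⁻¹' u := x.down.2.choose_spec.2
  refine ⟨x, ?_⟩
  rintro _ ⟨n, rfl⟩
  exact Set.ext_iff.1 hx n

/-- Accessibility for agent `i`. -/
def RK (i : I) (x y : WorldCode.{u, v, w} e) : Prop :=
  ∀ φ ∈ Set.range e, box (.K i) φ ∈ x.world → φ ∈ y.world

/-- The canonical frame. -/
abbrev frame (e : ℕ → Formula P I) (h : Nonempty (WorldCode.{u, v, w} e)) : KripkeFrame.{v, w} I where
  W := WorldCode.{u, v, w} e
  nonempty := h
  R := fun
    | .K i => RK i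
    | .C => Relation.ReflTransGen fun x y => ∃ i, RK i x y

theorem frame_mem (h : Nonempty (WorldCode.{u, v, w} e)) : frame e h ∈ FrmCKL I :=
  fun _ _ => Iff.rfl

/-- The canonical valuation. -/
def valuation (e : ℕ → Formula P I) (p : P) : Set (WorldCode.{u, v, w} e) :=
  {x | var p ∈ x.world}

theorem box_K_mem_iff (he : IsFragment (Set.range e)) (x : WorldCode.{u, v, w} e) (i : I)
    {φ : Formula P I} (hφ : φ ∈ Set.range e) :
    box (.K i) φ ∈ x.world ↔ ∀ y, RK i x y → φ ∈ y.world := by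
  refine ⟨fun h y hy => hy φ hφ h, fun h => ?_⟩
  by_contra hx
  obtain ⟨t, ht, hxt, hφt⟩ := x.isWorld.exists_successor he (Set.countable_range e) (.K i) hφ hx
  obtain ⟨y, hy⟩ := exists_code.{u, v, w} ht
  exact hφt ((hy φ hφ).1 (h y fun ψ hψ hx => (hy ψ hψ).2 (hxt ψ hx)))

/-- Forwards, `box .C φ` persists along each step by the mix axiom. Backwards, truth of `φ` at all
reachable worlds puts every `E^[n] φ` in `x`, and the world respects their conjunction. -/
theorem box_C_mem_iff (he : IsFragment (Set.range e)) (x : WorldCode.{u, v, w} e)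
    {φ : Formula P I} (hC : box .C φ ∈ Set.range e)
    (hE : iand (iterE φ) (iterE_countable φ) ∈ Set.range e) :
    box .C φ ∈ x.world ↔
      ∀ y, Relation.ReflTransGen (fun x y => ∃ i, RK i x y) x y → φ ∈ y.world := by
  constructor
  · intro h y hy
    have : box .C φ ∈ y.world := by
      induction hy with
      | refl => exact h
      | tail _ hi ih =>
        obtain ⟨i, hi⟩ := hi
        refine hi _ hC ?_
        exact (isWorld _).mp ((isWorld _).of_provable ((IPSMH.c_mix φ).imp_trans (.E_imp _ i))) ih
    exact y.isWorld.mp (y.isWorld.of_provable (.c_refl φ)) this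
  · intro h
    -- The world varies because the induction passes from `x` to its successors, which inherit the
    -- reachability hypothesis.
    have key : ∀ n : ℕ, ∀ x : WorldCode.{u, v, w} e,
        (∀ y, Relation.ReflTransGen (fun x y => ∃ i, RK i x y) x y → φ ∈ y.world) →
        E^[n] φ ∈ x.world := by
      intro n
      induction n with
      | zero => exact fun x h => h x .refl
      | succ n ih =>
        intro x h
        rw [Function.iterate_succ_apply']
        refine x.isWorld.E_mem fun i => ?_
        rw [box_K_mem_iff he x i (he.mem hE ⟨n, rfl⟩)]
        exact fun y hy => ih y fun z hz => h z (.head ⟨i, hy⟩ hz)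
    refine x.isWorld.mp (x.isWorld.of_provable (.iand_iterE_imp_C φ)) (x.isWorld.iand hE ?_)
    rintro _ ⟨n, rfl⟩
    exact key n x h

end WorldCode

open WorldCode in
/-- Every formula has a countable set of formulas such that the truth lemma holds for it in the
canonical model of each fragment that includes this set. -/
theorem exists_truth_lemma (φ : Formula P I) :
    ∃ B : Set (Formula P I), B.Countable ∧ φ ∈ B ∧
      ∀ e : ℕ → Formula P I, B ⊆ Set.range e → IsFragment (Set.range e) →
        ∀ (h : Nonempty (WorldCode.{u, v, w} e)) (x : WorldCode.{u, v, w} e),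
          x ∈ (frame e h).val (valuation e) φ ↔ φ ∈ x.world := by
  induction φ using Formula.induction with
  | var p => exact ⟨{var p}, Set.countable_singleton _, rfl, fun e _ _ h x => Iff.rfl⟩
  | top =>
    exact ⟨{top}, Set.countable_singleton _, rfl, fun e _ _ h x => iff_of_true trivial
      (x.isWorld.taut fun V ht _ _ _ _ => ht)⟩
  | bot =>
    exact ⟨{bot}, Set.countable_singleton _, rfl, fun e _ _ h x => iff_of_false id x.isWorld.bot⟩
  | and φ ψ ih₁ ih₂ =>
    obtain ⟨B₁, hc₁, -, h₁⟩ := ih₁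
    obtain ⟨B₂, hc₂, -, h₂⟩ := ih₂
    refine ⟨insert (and φ ψ) (B₁ ∪ B₂), (hc₁.union hc₂).insert _, Set.mem_insert _ _, ?_⟩
    intro e hB he h x
    obtain ⟨-, hB⟩ := Set.insert_subset_iff.1 hB
    obtain ⟨hB₁, hB₂⟩ := Set.union_subset_iff.1 hB
    rw [KripkeFrame.val_and, x.isWorld.and_mem_iff, ← h₁ e hB₁ he h, ← h₂ e hB₂ he h]
    rfl
  | neg φ ih =>
    obtain ⟨B, hc, hφ, h₁⟩ := ih
    refine ⟨insert (neg φ) B, hc.insert _, Set.mem_insert _ _, ?_⟩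
    intro e hB he h x
    obtain ⟨-, hB⟩ := Set.insert_subset_iff.1 hB
    rw [KripkeFrame.val_neg, x.isWorld.neg_mem_iff (hB hφ), ← h₁ e hB he h]
    rfl
  | box m φ ih =>
    obtain ⟨B, hc, hφ, h₁⟩ := ih
    refine ⟨insert (box m φ) (insert (iand (iterE φ) (iterE_countable φ)) B),
      (hc.insert _).insert _, Set.mem_insert _ _, ?_⟩
    intro e hins he h x
    obtain ⟨hm, hins⟩ := Set.insert_subset_iff.1 hins
    obtain ⟨hE, hB⟩ := Set.insert_subset_iff.1 hins
    rw [KripkeFrame.val_box]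
    have h₁ := h₁ e hB he h
    cases m with
    | K i =>
      rw [box_K_mem_iff he x i (hB hφ)]
      exact forall_congr' fun y => imp_congr_right fun _ => h₁ y
    | C =>
      rw [box_C_mem_iff he x hm hE]
      exact forall_congr' fun y => imp_congr_right fun _ => h₁ y
  | ior Γ hΓ ih =>
    choose! B hB using ih
    -- Worlds are only required to respect conjunctions, so a disjunction is handled through the
    -- conjunction of the negations of its members.
    refine ⟨insert (ior Γ hΓ) (insert (iand (neg '' Γ) (hΓ.image _)) (⋃ γ ∈ Γ, B γ)),
      ((hΓ.biUnion fun γ hγ => (hB γ hγ).1).insert _).insert _, Set.mem_insert _ _, ?_⟩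
    intro e hBe he h x
    obtain ⟨-, hBe⟩ := Set.insert_subset_iff.1 hBe
    obtain ⟨hN, hBe⟩ := Set.insert_subset_iff.1 hBe
    have hγe : ∀ γ ∈ Γ, B γ ⊆ Set.range e := fun γ hγ => (Set.subset_biUnion_of_mem hγ).trans hBe
    rw [KripkeFrame.val_ior]
    refine Set.mem_iUnion₂.trans ⟨?_, fun hx => ?_⟩
    · rintro ⟨γ, hγ, hx⟩
      exact x.isWorld.mp (x.isWorld.of_provable (.ior_intro Γ hΓ γ hγ))
        (((hB γ hγ).2.2 e (hγe γ hγ) he h x).1 hx)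
    · by_contra! hcon
      have hx' := x.isWorld.mp (x.isWorld.of_provable (.ior_imp_neg_iand Γ hΓ)) hx
      refine (x.isWorld.neg_mem_iff hN).1 hx' (x.isWorld.iand hN ?_)
      rintro _ ⟨γ, hγ, rfl⟩
      rw [x.isWorld.neg_mem_iff (hγe γ hγ (hB γ hγ).2.1), ← (hB γ hγ).2.2 e (hγe γ hγ) he h x]
      exact hcon γ hγ
  | iand Γ hΓ ih =>
    choose! B hB using ih
    refine ⟨insert (iand Γ hΓ) (⋃ γ ∈ Γ, B γ),
      (hΓ.biUnion fun γ hγ => (hB γ hγ).1).insert _, Set.mem_insert _ _, ?_⟩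
    intro e hBe he h x
    obtain ⟨hN, hBe⟩ := Set.insert_subset_iff.1 hBe
    rw [KripkeFrame.val_iand]
    have key : ∀ γ ∈ Γ, (x ∈ (frame e h).val (valuation e) γ ↔ γ ∈ x.world) := fun γ hγ =>
      (hB γ hγ).2.2 e ((Set.subset_biUnion_of_mem hγ).trans hBe) he h x
    refine Set.mem_iInter₂.trans ((forall₂_congr key).trans ⟨x.isWorld.iand hN, fun hx γ hγ => ?_⟩)
    exact x.isWorld.mp (x.isWorld.of_provable (.iand_elim Γ hΓ γ hγ)) hx

open WorldCode in
-- The set of theorems is itself a complete theory, so an unprovable `φ` is omitted by some world of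
-- a fragment large enough for its truth lemma, and fails there.
theorem IPSMH.complete {φ : Formula P I} (hφ : ValidIn (FrmCKL.{v, w} I) φ) : IPSMH φ := by
  by_contra hn
  obtain ⟨B, hB, hφB, htruth⟩ := exists_truth_lemma.{u, v, w} φ
  obtain ⟨A, hBA, hAc, hA⟩ := exists_fragment hB
  obtain ⟨e, rfl⟩ := hAc.exists_eq_range ⟨φ, hBA hφB⟩
  obtain ⟨t, ht, -, hφt⟩ := (IsCompleteTheory.provable _).exists_world hA hAc (hBA hφB) hn
  obtain ⟨x, hx⟩ := exists_code.{u, v, w} ht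
  have hval := hφ (frame e ⟨x⟩) (frame_mem ⟨x⟩) (valuation e)
  have hmem : x ∈ (frame e ⟨x⟩).val (valuation e) φ := hval ▸ Set.mem_univ x
  exact hφt ((hx φ (hBA hφB)).1 ((htruth e hBA hA ⟨x⟩ x).1 hmem))

end CanonicalModel

end CKL

theorem mainTheorem8 {P : Type u} [Countable P] {I : Type v} [Fintype I] [Nonempty I]
    (φ : CKL.Formula P I) :
    CKL.IPSMH φ ↔ CKL.ValidIn (CKL.FrmCKL.{v, w} I) φ :=
  ⟨fun h F hF v => Set.eq_univ_of_forall (h.sound F hF v), .complete⟩
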